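/- Let $V=V_b\cup V_r$ be a finite set of nodes, with $V_r\neq\emptyset$ the reference nodes, and let each node $u$ have a constant variable $x_u\in\mathbb R$, known at the reference nodes (e.g. $x_u=0$ for $u\in V_r$). For $k=0,1,\dots$ let $\mathcal G(k)=(V,\mathcal E(k))$ be a deterministic sequence of undirected graphs, put $a_{uv}(k)=1$ if $(u,v)\in\mathcal E(k)$ and $a_{uv}(k)=0$ otherwise, and let $\mathcal N_u(k)$ be the set of neighbors of $u$ in $\mathcal G(k)$. In the DiSync algorithm the reference nodes keep $\hat x_u(k)=x_u$, and every $u\in V_b$ starts from some $\hat x_u(0)$ and updates $$\hat x_u(k+1)=\hat x_u(k)+m(k)\sum_{v\in\mathcal N_u(k)}\bigl(\hat x_v(k)+\zeta_{u,v}(k)-\hat x_u(k)\bigr),\qquad \zeta_{u,v}(k)=x_u-x_v+\epsilon_{u,v}(k).$$ Let $e(k)=(\hat x_u(k)-x_u)_{u\in V_b}$ be the estimation error and $\epsilon(k)=(\epsilon_{u,v}(k))_{u\in V_b,\,v\in V,\,v\ne u}$ the noise vector. Let $L(k)$ be the Laplacian of $\mathcal G(k)$, $L_b(k)$ (the grounded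 Laplacian) its submatrix with rows and columns in $V_b$, and $D(k)$ the block diagonal matrix whose block for $u\in V_b$ is the row $(a_{uv}(k))_{v\in V,\,v\neq u}$, so that $$e(k+1)=(I-m(k)L_b(k))\,e(k)+m(k)D(k)\,\epsilon(k).$$ Assume: 1. $E[\epsilon(k)]=\gamma$ for all $k$, $\sup_k E\|\epsilon(k)\|^2<\infty$, $\epsilon(k)$ and $\epsilon(j)$ are independent for $k\ne j$, the sequence $\{\epsilon(k)\}_{k\ge0}$ is independent of $e(0)$, and $E\|e(0)\|^2<\infty$; 2. $m(k)=\frac{c_1}{k+c_2}$ for all $k\ge 0$, with constants $c_1,c_2>0$; 3. there is $d\in\mathbb N$ such that for every $t\ge 0$ the graph $\bigl(V,\bigcup_{k=t}^{t+d-1}\mathcal E(k)\bigr)$ is connected; 4. the limits $\bar L=\lim_{t\to\infty}\frac1t\sum_{k=0}^tL(k)$, $\bar L_b=\lim_{t\to\infty}\frac1t\sum_{k=0}^tL_b(k)$ and $\bar D=\lim_{t\to\infty}\frac1t\sum_{k=0}^tD(k)$ exist. Then $\bar L_b$ is invertible and $e(k)$ converges to $\bar L_b^{-1}\bar D\gamma$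 in mean square: $$\lim_{k\to\infty}E\bigl\|e(k)-\bar L_b^{-1}\bar D\gamma\bigr\|^2=0 .$$ In particular, if the measurements are unbiased ($\gamma=0$), then $\lim_{k\to\infty}E\|e(k)\|^2=0$. -/

import Mathlib

open MeasureTheory ProbabilityTheory Filter Topology

/-- Grounded (Dirichlet) Laplacian: the Laplacian with the rows and columns of the
reference nodes `R` removed. Nodes are `B ⊕ R`, where `B` are the non-reference nodes. -/
def groundedLaplacian {B R : Type*} [Fintype B] [Fintype R] [DecidableEq B] [DecidableEq R]
    (G : SimpleGraph (B ⊕ R)) [DecidableRel G.Adj] : Matrix B B ℝ :=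
  (G.lapMatrix ℝ).submatrix Sum.inl Sum.inl

/-- Ordered pairs `(u, v)` with `u` a non-reference node and `v ≠ u` any node. -/
abbrev NodePair (B R : Type*) := {p : B × (B ⊕ R) // p.2 ≠ Sum.inl p.1}

/-- The block diagonal matrix `diag(ā_1, …, ā_{n_b})`, where `ā_u` is the row of the
weights `a_{uv}`, `v ≠ u` (with `a_{uv} = 1` on edges and `0` otherwise). -/
def weightMatrix {B R : Type*} [DecidableEq B]
    (G : SimpleGraph (B ⊕ R)) [DecidableRel G.Adj] : Matrix B (NodePair B R) ℝ :=
  Matrix.of fun u p => if p.1.1 = u then G.adjMatrix ℝ (Sum.inl u) p.1.2 else 0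

/-- The noises `ξ_{u,v}`, `v ≠ u`, stacked into one vector. -/
def stackedNoise {B R : Type*} (ξ : B → B ⊕ R → ℝ) : EuclideanSpace ℝ (NodePair B R) :=
  WithLp.toLp 2 fun p => ξ p.1.1 p.1.2

/-- The noisy difference measurement `ζ_{u,v} = x_u - x_v + ξ_{u,v}` used by node `u`. -/
def diffMeasurement {B R : Type*} (x : B ⊕ R → ℝ) (ξ : B → B ⊕ R → ℝ)
    (u : B) (v : B ⊕ R) : ℝ :=
  x (Sum.inl u) - x v + ξ u v

/-- The estimates of the DiSync algorithm with gains `m`, measurement graphs `G`, node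
variables `x`, measurement noises `ξ`, and initial estimates `x₀` at the non-reference nodes.
Reference nodes know their node variables and do not update. -/
def diSyncEstimate {B R : Type*} [Fintype B] [Fintype R]
    (m : ℕ → ℝ) (G : ℕ → SimpleGraph (B ⊕ R)) [∀ k, DecidableRel (G k).Adj]
    (x : B ⊕ R → ℝ) (ξ : ℕ → B → B ⊕ R → ℝ) (x₀ : B → ℝ) : ℕ → B ⊕ R → ℝ
  | 0 => Sum.elim x₀ (fun r => x (Sum.inr r))
  | k + 1 => Sum.elim
      (fun u => diSyncEstimate m G x ξ x₀ k (Sum.inl u) +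
        m k * ∑ v ∈ (G k).neighborFinset (Sum.inl u),
          (diSyncEstimate m G x ξ x₀ k v + diffMeasurement x (ξ k) u v
            - diSyncEstimate m G x ξ x₀ k (Sum.inl u)))
      (fun r => x (Sum.inr r))

/-- The estimation error `e_u(k) = x̂_u(k) - x_u` at the non-reference nodes. -/
def diSyncError {B R : Type*} [Fintype B] [Fintype R]
    (m : ℕ → ℝ) (G : ℕ → SimpleGraph (B ⊕ R)) [∀ k, DecidableRel (G k).Adj]
    (x : B ⊕ R → ℝ) (ξ : ℕ → B → B ⊕ R → ℝ) (x₀ : B → ℝ) (k : ℕ) : EuclideanSpace ℝ B :=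
  WithLp.toLp 2 fun u => diSyncEstimate m G x ξ x₀ k (Sum.inl u) - x (Sum.inl u)

/-- The time average `(1/t) ∑_{k=0}^{t} A(k)`. -/
noncomputable def timeAverage {M : Type*} [AddCommMonoid M] [Module ℝ M] (A : ℕ → M) (t : ℕ) : M :=
  (t : ℝ)⁻¹ • ∑ k ∈ Finset.range (t + 1), A k

/-! Each grounded Laplacian may be singular, so no single step need contract; only the time average
`A` is positive definite. Indeed, every window of length `d` has an edge across which the zero
extension of a given nonzero vector changes (`dotProduct_averaged_groundedLaplacian_pos`).

Centre at `s = Lbbar⁻¹ Dbar γ`, so that the remaining forcing `f` averages to zero. Because `m k` is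
of order `1/k`, the sums `H k = m k • ∑_{j<k} (L j - A)` and `h k = m k • ∑_{j<k} f j` tend to zero.
In the variable `u = y + H y - h` the increments of `H` and `h` replace `L k` by `A` and cancel `f
k`, up to errors `m k * o(1)` (`exists_corrected_step_contraction`). Coercivity of `A` then
contracts `u` at rate `β * m k`.

The noise is orthogonal to the current state, so it adds only `O(m k ^ 2)` to the second moment.
Since the gains vanish and are not summable, `tendsto_zero_of_le_contraction` gives `E‖u‖² → 0`, and
`H, h → 0` carries this back to `y`. -/

/-! ### Gains and a discrete Grönwall inequality. -/

lemma tendsto_sum_gain {c₁ c₂ : ℝ} (hc₁ : 0 < c₁) (hc₂ : 0 < c₂) {m : ℕ → ℝ}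
    (hm : ∀ k, m k = c₁ / ((k : ℝ) + c₂)) :
    Tendsto (fun n => ∑ k ∈ Finset.range n, m k) atTop atTop := by
  have hpos : ∀ k, 0 ≤ m k := fun k => by rw [hm]; positivity
  rw [← not_summable_iff_tendsto_nat_atTop_of_nonneg hpos]
  intro hs
  have h := (Real.summable_one_div_nat_add_rpow c₂ 1).not.2 (lt_irrefl 1)
  apply h
  refine (hs.mul_left c₁⁻¹).congr fun k => ?_
  have : (0 : ℝ) < k + c₂ := by positivity
  rw [hm, Real.rpow_one, abs_of_pos this]
  field_simp

lemma tendsto_gain {c₁ c₂ : ℝ} {m : ℕ → ℝ}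
    (hm : ∀ k, m k = c₁ / ((k : ℝ) + c₂)) : Tendsto m atTop (𝓝 0) := by
  rw [funext hm]
  exact tendsto_const_nhds.div_atTop
    (tendsto_atTop_add_const_right _ _ tendsto_natCast_atTop_atTop)

/-- A discrete Grönwall-type lemma: contraction at a non-summable rate, with a vanishing forcing
term, drives a nonnegative sequence to zero. -/
lemma tendsto_zero_of_le_contraction {a b α : ℕ → ℝ} (ha : ∀ k, 0 ≤ a k) (hα : ∀ k, 0 ≤ α k)
    (hα0 : Tendsto α atTop (𝓝 0))
    (hαsum : Tendsto (fun n => ∑ k ∈ Finset.range n, α k) atTop atTop)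
    (hb : Tendsto b atTop (𝓝 0))
    (h : ∀ᶠ k in atTop, a (k + 1) ≤ (1 - α k) * a k + α k * b k) :
    Tendsto a atTop (𝓝 0) := by
  refine Metric.tendsto_atTop.2 fun ε hε => ?_
  obtain ⟨K, hK⟩ := eventually_atTop.1
    (h.and ((hα0.eventually_le_const one_pos).and (hb.eventually_le_const (half_pos hε))))
  -- Once `b ≤ ε / 2`, the excess over `ε / 2` obeys a recursion without forcing.
  set p : ℕ → ℝ := fun k => max (a k - ε / 2) 0 with hp
  have hp0 : ∀ k, 0 ≤ p k := fun k => le_max_right _ _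
  have hstep : ∀ k ≥ K, p (k + 1) ≤ Real.exp (-α k) * p k := by
    intro k hk
    obtain ⟨h1, h2, h3⟩ := hK k hk
    have h4 : 1 - α k ≤ Real.exp (-α k) := by linarith [Real.add_one_le_exp (-α k)]
    have h5 : a k - ε / 2 ≤ p k := le_max_left _ _
    refine max_le ?_ (mul_nonneg (Real.exp_pos _).le (hp0 k))
    calc a (k + 1) - ε / 2 ≤ (1 - α k) * (a k - ε / 2) := by
          nlinarith [mul_le_mul_of_nonneg_left h3 (hα k)]
      _ ≤ (1 - α k) * p k := mul_le_mul_of_nonneg_left h5 (by linarith)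
      _ ≤ _ := mul_le_mul_of_nonneg_right h4 (hp0 k)
  have hbound : ∀ k ≥ K, p k ≤ Real.exp (∑ j ∈ Finset.range K, α j
      - ∑ j ∈ Finset.range k, α j) * p K := by
    intro k hk
    induction k, hk using Nat.le_induction with
    | base => simp
    | succ k hk ih =>
      refine (hstep k hk).trans ((mul_le_mul_of_nonneg_left ih (Real.exp_pos _).le).trans_eq ?_)
      rw [← mul_assoc, ← Real.exp_add, Finset.sum_range_succ]
      ring_nf
  have hlim : Tendsto (fun k => Real.exp (∑ j ∈ Finset.range K, α j
      - ∑ j ∈ Finset.range k, α j) * p K) atTop (𝓝 0) := by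
    rw [← zero_mul (p K)]
    exact (Real.tendsto_exp_atBot.comp
      (tendsto_atBot_add_const_left _ _ (tendsto_neg_atTop_atBot.comp hαsum))).mul_const _
  obtain ⟨N, hN⟩ := eventually_atTop.1 (hlim.eventually_lt_const (half_pos hε))
  refine ⟨max K N, fun k hk => ?_⟩
  have h1 := hbound k (le_of_max_le_left hk)
  have h2 := hN k (le_of_max_le_right hk)
  have h3 : a k - ε / 2 ≤ p k := le_max_left _ _
  rw [Real.dist_eq, sub_zero, abs_of_nonneg (ha k)]
  linarith

/-! ### Coercive operators and weighted averages. -/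

section Hilbert

variable {E : Type*} [NormedAddCommGroup E] [InnerProductSpace ℝ E]

/-- Expanding the square gives the factor `1 - 2tl + t²‖A‖² ≤ 1 - tl ≤ (1 - tl/2)²`; symmetry of `A`
plays no role. -/
lemma norm_sub_smul_le_of_coercive {A : E →L[ℝ] E} {l t : ℝ}
    (hA : ∀ u, l * ‖u‖ ^ 2 ≤ inner ℝ u (A u)) (ht : 0 ≤ t) (htA : t * ‖A‖ ^ 2 ≤ l)
    (htl : t * l ≤ 1) (u : E) : ‖u - t • A u‖ ≤ (1 - l / 2 * t) * ‖u‖ := by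
  have h1 : ‖A u‖ ^ 2 ≤ ‖A‖ ^ 2 * ‖u‖ ^ 2 := by
    rw [← mul_pow]
    exact pow_le_pow_left₀ (norm_nonneg _) (A.le_opNorm u) 2
  refine (pow_le_pow_iff_left₀ (norm_nonneg _) (mul_nonneg (by nlinarith) (norm_nonneg _))
    two_ne_zero).1 ?_
  rw [norm_sub_sq_real, inner_smul_right, norm_smul, mul_pow, Real.norm_eq_abs, sq_abs]
  have h2 := mul_le_mul_of_nonneg_left (hA u) ht
  have h3 := mul_le_mul_of_nonneg_left h1 (sq_nonneg t)
  have h4 := mul_le_mul_of_nonneg_right htA (mul_nonneg ht (sq_nonneg ‖u‖))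
  nlinarith [sq_nonneg (l * t * ‖u‖)]

lemma exists_coercive_of_pos [FiniteDimensional ℝ E] {A : E →L[ℝ] E}
    (hA : ∀ u, u ≠ 0 → 0 < inner ℝ u (A u)) :
    ∃ l > 0, ∀ u, l * ‖u‖ ^ 2 ≤ inner ℝ u (A u) := by
  rcases subsingleton_or_nontrivial E with hE | hE
  · exact ⟨1, one_pos, fun u => by simp [Subsingleton.elim u 0]⟩
  have hc : Continuous fun u : E => inner ℝ u (A u) := by fun_prop
  obtain ⟨v, hv, hmin⟩ := (isCompact_sphere (0 : E) 1).exists_isMinOn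
    (NormedSpace.sphere_nonempty.2 zero_le_one) hc.continuousOn
  have hv1 : ‖v‖ = 1 := by simpa using hv
  refine ⟨inner ℝ v (A v), hA v (by rintro rfl; simp at hv1), fun u => ?_⟩
  rcases eq_or_ne u 0 with rfl | hu
  · simp
  have hu' : ‖u‖ ≠ 0 := norm_ne_zero_iff.2 hu
  have h := hmin (show ‖u‖⁻¹ • u ∈ Metric.sphere (0 : E) 1 by simp [norm_smul, hu'])
  simp only [Set.mem_ofPred_eq, map_smul, inner_smul_left, inner_smul_right,
    conj_trivial] at h
  calc _ ≤ (‖u‖⁻¹ * (‖u‖⁻¹ * inner ℝ u (A u))) * ‖u‖ ^ 2 :=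
        mul_le_mul_of_nonneg_right h (sq_nonneg _)
    _ = _ := by field_simp

end Hilbert

/-- Gain-weighted partial sums of a sequence with vanishing time average tend to zero. -/
lemma tendsto_gain_smul_sum {M : Type*} [NormedAddCommGroup M] [NormedSpace ℝ M]
    {c₁ c₂ : ℝ} {m : ℕ → ℝ}
    (hm : ∀ k, m k = c₁ / ((k : ℝ) + c₂)) {A : ℕ → M} {A' : M}
    (hA : Tendsto (timeAverage A) atTop (𝓝 A')) :
    Tendsto (fun k => m k • ∑ j ∈ Finset.range k, (A j - A')) atTop (𝓝 0) := by
  -- `timeAverage` divides `t + 1` terms by `t`. After the shift the sum is `k` times the centred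
  -- average minus one extra `A'`, which the gain kills.
  rw [← tendsto_add_atTop_iff_nat 1]
  have h1 : Tendsto (fun k : ℕ => ((k : ℝ) * m (k + 1))) atTop (𝓝 c₁) := by
    have h := (tendsto_natCast_div_add_atTop (1 + c₂)).const_mul c₁
    rw [mul_one] at h
    refine h.congr fun k => ?_
    rw [hm]
    push_cast
    ring
  have h2 : Tendsto (fun k : ℕ => m (k + 1)) atTop (𝓝 0) :=
    (tendsto_add_atTop_iff_nat 1).2 (tendsto_gain hm)
  have h3 := (h1.smul (hA.sub_const A')).sub (h2.smul_const A')
  rw [sub_self, smul_zero, zero_smul, sub_zero] at h3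
  refine h3.congr' ?_
  filter_upwards [eventually_ne_atTop 0] with k hk
  have hk' : (k : ℝ) ≠ 0 := Nat.cast_ne_zero.2 hk
  rw [Finset.sum_sub_distrib, Finset.sum_const, Finset.card_range, timeAverage, smul_sub,
    smul_sub, smul_smul, mul_right_comm, mul_inv_cancel₀ hk', one_mul, sub_sub, mul_comm,
    mul_smul, ← smul_add, ← Nat.cast_smul_eq_nsmul ℝ, Nat.cast_add, Nat.cast_one, add_smul,
    one_smul]

/-! ### Grounded Laplacians and joint connectivity. -/

section Graph

variable {B R : Type*} [Fintype B] [DecidableEq B] [Fintype R] [DecidableEq R]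

/-- Extending `y` by zero to the reference nodes turns the grounded form into the full Dirichlet
form. -/
lemma dotProduct_groundedLaplacian_mulVec (G : SimpleGraph (B ⊕ R)) [DecidableRel G.Adj]
    (y : B → ℝ) :
    y ⬝ᵥ (groundedLaplacian G).mulVec y =
      (∑ i, ∑ j, if G.Adj i j then
        (Sum.elim y (fun _ : R => (0 : ℝ)) i - Sum.elim y (fun _ => 0) j) ^ 2 else 0) / 2 := by
  rw [← SimpleGraph.lapMatrix_toLinearMap₂', Matrix.toLinearMap₂'_apply']
  simp [dotProduct, Matrix.mulVec, groundedLaplacian, Fintype.sum_sum_type]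

lemma dotProduct_groundedLaplacian_mulVec_nonneg (G : SimpleGraph (B ⊕ R)) [DecidableRel G.Adj]
    (y : B → ℝ) : 0 ≤ y ⬝ᵥ (groundedLaplacian G).mulVec y := by
  rw [dotProduct_groundedLaplacian_mulVec]
  refine div_nonneg (Finset.sum_nonneg fun i _ => Finset.sum_nonneg fun j _ => ?_) two_pos.le
  split_ifs <;> positivity

lemma sq_le_two_mul_dotProduct_groundedLaplacian (G : SimpleGraph (B ⊕ R)) [DecidableRel G.Adj]
    (y : B → ℝ) {i j : B ⊕ R} (hij : G.Adj i j) :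
    (Sum.elim y (fun _ => (0 : ℝ)) i - Sum.elim y (fun _ => 0) j) ^ 2 ≤
      2 * (y ⬝ᵥ (groundedLaplacian G).mulVec y) := by
  rw [dotProduct_groundedLaplacian_mulVec, mul_div_cancel₀ _ two_ne_zero]
  have hnn : ∀ a b, 0 ≤ if G.Adj a b then
      (Sum.elim y (fun _ => (0 : ℝ)) a - Sum.elim y (fun _ => 0) b) ^ 2 else 0 := by
    intro a b; split_ifs <;> positivity
  refine le_trans ?_ (Finset.single_le_sum (fun a _ => Finset.sum_nonneg fun b _ => hnn a b)
    (Finset.mem_univ i))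
  refine le_trans ?_ (Finset.single_le_sum (fun b _ => hnn i b) (Finset.mem_univ j))
  rw [if_pos hij]

lemma exists_adj_ne_of_connected_iSup {V ι α : Type*} {G : ι → SimpleGraph V} {s : Set ι}
    (hG : (⨆ k ∈ s, G k).Connected) {f : V → α} {a b : V} (hab : f a ≠ f b) :
    ∃ k ∈ s, ∃ i j, (G k).Adj i j ∧ f i ≠ f j := by
  by_contra! hcon
  obtain ⟨p⟩ := hG.preconnected a b
  refine hab ?_
  clear hab
  induction p with
  | nil => rfl
  | cons h _ ih =>
    simp only [SimpleGraph.iSup_adj] at h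
    obtain ⟨k, hk, h⟩ := h
    exact (hcon k hk _ _ h).trans ih

/-- `δ` is uniform in `t` because the zero extension has finitely many differences: half the least
nonzero squared one works for every window. -/
lemma exists_window_lower_bound [Nonempty R] {G : ℕ → SimpleGraph (B ⊕ R)}
    [∀ k, DecidableRel (G k).Adj] {d : ℕ}
    (hconn : ∀ t : ℕ, (⨆ k ∈ Set.Ico t (t + d), G k).Connected) {y : B → ℝ} (hy : y ≠ 0) :
    ∃ δ > 0, ∀ t, δ ≤ ∑ k ∈ Finset.Ico t (t + d), y ⬝ᵥ (groundedLaplacian (G k)).mulVec y := by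
  set z : B ⊕ R → ℝ := Sum.elim y (fun _ => 0)
  obtain ⟨b, hb⟩ := Function.ne_iff.1 hy
  obtain ⟨r⟩ := ‹Nonempty R›
  have hne : z (Sum.inl b) ≠ z (Sum.inr r) := hb
  obtain ⟨p, hp, hmin⟩ := (Finset.univ.filter fun p : (B ⊕ R) × (B ⊕ R) =>
    z p.1 ≠ z p.2).exists_min_image (fun p => (z p.1 - z p.2) ^ 2)
    ⟨(Sum.inl b, Sum.inr r), by simpa using hne⟩
  have hp' : z p.1 ≠ z p.2 := by simpa using hp
  have hsub := sub_ne_zero.2 hp'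
  refine ⟨(z p.1 - z p.2) ^ 2 / 2, by positivity, fun t => ?_⟩
  obtain ⟨k, hk, i, j, hadj, hij⟩ := exists_adj_ne_of_connected_iSup (hconn t) hne
  have h1 := hmin (i, j) (by simpa using hij)
  have h2 := sq_le_two_mul_dotProduct_groundedLaplacian (G k) y hadj
  have h3 := Finset.single_le_sum
    (fun k _ => dotProduct_groundedLaplacian_mulVec_nonneg (G k) y)
    (Finset.mem_Ico.2 hk : k ∈ Finset.Ico t (t + d))
  simp only at h1 h3
  change (z i - z j) ^ 2 ≤ _ at h2
  linarith

lemma dotProduct_averaged_groundedLaplacian_pos [Nonempty R] {G : ℕ → SimpleGraph (B ⊕ R)}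
    [∀ k, DecidableRel (G k).Adj]
    (hconn : ∃ d : ℕ, ∀ t : ℕ, (⨆ k ∈ Set.Ico t (t + d), G k).Connected)
    {A : Matrix B B ℝ}
    (hA : Tendsto (timeAverage fun k => groundedLaplacian (G k)) atTop (𝓝 A))
    {y : B → ℝ} (hy : y ≠ 0) : 0 < y ⬝ᵥ A.mulVec y := by
  obtain ⟨d, hd⟩ := hconn
  obtain ⟨δ, hδ, hδw⟩ := exists_window_lower_bound hd hy
  have hd0 : 0 < d := by
    rcases Nat.eq_zero_or_pos d with rfl | h
    · have := hδw 0
      simp at this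
      linarith
    · exact h
  have hwin : ∀ n : ℕ, n * δ ≤
      ∑ k ∈ Finset.range (n * d), y ⬝ᵥ (groundedLaplacian (G k)).mulVec y := by
    intro n
    induction n with
    | zero => simp
    | succ n ih =>
      have h1 := hδw (n * d)
      have h2 := Finset.sum_range_add_sum_Ico
        (fun k => y ⬝ᵥ (groundedLaplacian (G k)).mulVec y) (Nat.le_add_right (n * d) d)
      rw [Nat.succ_mul, ← h2]
      push_cast
      linarith
  have hlim : Tendsto (fun t => y ⬝ᵥ (timeAverage (fun k => groundedLaplacian (G k)) t).mulVec y)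
      atTop (𝓝 (y ⬝ᵥ A.mulVec y)) := by
    have hc : Continuous fun M : Matrix B B ℝ => y ⬝ᵥ M.mulVec y := by fun_prop
    exact (hc.tendsto A).comp hA
  -- Whole windows suffice, since the limit is known to exist; `n + 1` avoids dividing by zero.
  have hsub : Tendsto (fun n : ℕ => (n + 1) * d) atTop atTop :=
    tendsto_atTop_mono (fun n => (Nat.le_succ n).trans (Nat.le_mul_of_pos_right _ hd0))
      tendsto_id
  have hge : δ / d ≤ y ⬝ᵥ A.mulVec y := by
    refine ge_of_tendsto (hlim.comp hsub) (Eventually.of_forall fun n => ?_)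
    have h1 := hwin (n + 1)
    have h2 := dotProduct_groundedLaplacian_mulVec_nonneg (G ((n + 1) * d)) y
    simp only [Function.comp, timeAverage, Matrix.smul_mulVec, Matrix.sum_mulVec,
      dotProduct_smul, dotProduct_sum, smul_eq_mul]
    rw [Finset.sum_range_succ, inv_mul_eq_div, div_le_div_iff₀ (by positivity) (by positivity)]
    push_cast at h1 ⊢
    have hd' : (0 : ℝ) < d := Nat.cast_pos.2 hd0
    nlinarith
  exact lt_of_lt_of_le (by positivity) hge

/-- The true differences in the measurements cancel, and the error vanishes at reference nodes, so
only the grounded block of the Laplacian acts. -/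
lemma diSyncError_succ (m : ℕ → ℝ) (G : ℕ → SimpleGraph (B ⊕ R)) [∀ k, DecidableRel (G k).Adj]
    (x : B ⊕ R → ℝ) (ξ : ℕ → B → B ⊕ R → ℝ) (x₀ : B → ℝ) (k : ℕ) :
    (diSyncError m G x ξ x₀ (k + 1)).ofLp =
      Matrix.mulVec (1 - m k • groundedLaplacian (G k)) (diSyncError m G x ξ x₀ k).ofLp +
        m k • Matrix.mulVec (weightMatrix (G k)) (stackedNoise (ξ k)).ofLp := by
  have hR : ∀ r, diSyncEstimate m G x ξ x₀ k (Sum.inr r) = x (Sum.inr r) := by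
    cases k <;> simp [diSyncEstimate]
  have hlap : ∀ u, (groundedLaplacian (G k)).mulVec (diSyncError m G x ξ x₀ k).ofLp u =
      ∑ v ∈ (G k).neighborFinset (Sum.inl u),
        ((diSyncEstimate m G x ξ x₀ k (Sum.inl u) - x (Sum.inl u)) -
          (diSyncEstimate m G x ξ x₀ k v - x v)) := by
    intro u
    have h1 : (groundedLaplacian (G k)).mulVec (diSyncError m G x ξ x₀ k).ofLp u =
        ((G k).lapMatrix ℝ).mulVec (fun v => diSyncEstimate m G x ξ x₀ k v - x v)
          (Sum.inl u) := by
      simp [Matrix.mulVec, dotProduct, Fintype.sum_sum_type, groundedLaplacian, hR, diSyncError]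
    rw [h1, SimpleGraph.lapMatrix_mulVec_apply]
    simp only [Finset.sum_sub_distrib, Finset.sum_const,
      SimpleGraph.card_neighborFinset_eq_degree, nsmul_eq_mul]
    ring
  have hw : ∀ u, (weightMatrix (G k)).mulVec (stackedNoise (ξ k)).ofLp u =
      ∑ v ∈ (G k).neighborFinset (Sum.inl u), ξ k u v := by
    intro u
    simp only [Matrix.mulVec, dotProduct, weightMatrix, stackedNoise, Matrix.of_apply, ite_mul,
      zero_mul]
    rw [← Finset.sum_filter]
    refine Finset.sum_bij_ne_zero (fun p _ _ => p.1.2) ?_ ?_ ?_ ?_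
    · intro p hp hne
      simp only [Finset.mem_filter, Finset.mem_univ, true_and] at hp
      rw [SimpleGraph.mem_neighborFinset]
      by_contra hadj
      simp [SimpleGraph.adjMatrix_apply, hadj] at hne
    · intro p hp _ q hq _ h
      simp only [Finset.mem_filter, Finset.mem_univ, true_and] at hp hq
      exact Subtype.ext (Prod.ext (hp.trans hq.symm) h)
    · intro v hv hne
      rw [SimpleGraph.mem_neighborFinset] at hv
      exact ⟨⟨(u, v), hv.ne'⟩, by simp, by simpa [SimpleGraph.adjMatrix_apply, hv] using hne, rfl⟩
    · intro p hp hne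
      simp only [Finset.mem_filter, Finset.mem_univ, true_and] at hp
      have hadj : (G k).Adj (Sum.inl u) p.1.2 := by
        by_contra hadj
        simp [SimpleGraph.adjMatrix_apply, hadj] at hne
      simp [SimpleGraph.adjMatrix_apply, hadj, hp]
  funext u
  rw [Matrix.sub_mulVec, Matrix.one_mulVec, Matrix.smul_mulVec, Pi.add_apply, Pi.sub_apply,
    Pi.smul_apply, Pi.smul_apply, hlap, hw]
  simp only [diSyncError, diSyncEstimate, Sum.elim_inl, smul_eq_mul, diffMeasurement]
  have hsum : ∑ v ∈ (G k).neighborFinset (Sum.inl u),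
      (diSyncEstimate m G x ξ x₀ k v + (x (Sum.inl u) - x v + ξ k u v) -
        diSyncEstimate m G x ξ x₀ k (Sum.inl u)) =
      ∑ v ∈ (G k).neighborFinset (Sum.inl u), ξ k u v -
      ∑ v ∈ (G k).neighborFinset (Sum.inl u),
        ((diSyncEstimate m G x ξ x₀ k (Sum.inl u) - x (Sum.inl u)) -
          (diSyncEstimate m G x ξ x₀ k v - x v)) := by
    rw [← Finset.sum_sub_distrib]
    exact Finset.sum_congr rfl fun v _ => by ring
  rw [hsum]
  ring

end Graph

/-! ### The averaging change of variables. -/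

/-- The identity is exact because `1 / m (k + 1) - 1 / m k = 1 / c₁`. -/
lemma gain_smul_sum_succ {M : Type*} [AddCommGroup M] [Module ℝ M]
    {c₁ c₂ : ℝ} (hc₁ : 0 < c₁) (hc₂ : 0 < c₂) {m : ℕ → ℝ}
    (hm : ∀ k, m k = c₁ / ((k : ℝ) + c₂)) (a : ℕ → M) (k : ℕ) :
    m (k + 1) • ∑ j ∈ Finset.range (k + 1), a j =
      m k • ∑ j ∈ Finset.range k, a j + m k • a k -
        (m k / c₁) • (m (k + 1) • ∑ j ∈ Finset.range (k + 1), a j) := by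
  have h : m (k + 1) = m k - m k / c₁ * m (k + 1) := by
    have h1 : (0 : ℝ) < k + c₂ := by positivity
    have h2 : (0 : ℝ) < k + 1 + c₂ := by positivity
    rw [hm, hm]
    push_cast
    field_simp
    ring
  rw [← smul_add, ← Finset.sum_range_succ, smul_smul, ← sub_smul, ← h]

section Hilbert

variable {E : Type*} [NormedAddCommGroup E] [InnerProductSpace ℝ E]

/-- One step of the averaged recursion: after the near-identity change of variables
`u = y + H y - h`, the deterministic part of the update contracts up to a vanishing error. -/
lemma exists_corrected_step_contraction [FiniteDimensional ℝ E] {L H : ℕ → E →L[ℝ] E} {A : E →L[ℝ] E} {f h : ℕ → E}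
    {c₁ CL Cf : ℝ} {m : ℕ → ℝ} (hc₁ : 0 < c₁) (hm0 : ∀ k, 0 ≤ m k)
    (hm : Tendsto m atTop (𝓝 0)) (hL : ∀ k, ‖L k‖ ≤ CL) (hf : ∀ k, ‖f k‖ ≤ Cf)
    (hA : ∀ u, u ≠ 0 → 0 < inner ℝ u (A u))
    (hH : Tendsto H atTop (𝓝 0)) (hh : Tendsto h atTop (𝓝 0))
    (hH_succ : ∀ k, H (k + 1) = H k + m k • (L k - A) - (m k / c₁) • H (k + 1))
    (hh_succ : ∀ k, h (k + 1) = h k + m k • f k - (m k / c₁) • h (k + 1)) :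
    ∃ β > 0, ∃ η : ℕ → ℝ, Tendsto η atTop (𝓝 0) ∧ ∀ᶠ k in atTop, ∀ y z : E,
      z = y - m k • L k y + m k • f k →
      ‖z + H (k + 1) z - h (k + 1)‖ ≤
        (1 - β * m k) * ‖y + H k y - h k‖ + β * m k * η k := by
  obtain ⟨l, hl, hcoer⟩ := exists_coercive_of_pos hA
  set θ : ℕ → ℝ := fun k => ‖A‖ * (‖H k‖ + ‖h k‖) + c₁⁻¹ * (‖H (k + 1)‖ + ‖h (k + 1)‖) +
    ‖H (k + 1)‖ * (CL + Cf) with hθ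
  have hHn : Tendsto (fun k => ‖H k‖) atTop (𝓝 0) := by simpa using hH.norm
  have hhn : Tendsto (fun k => ‖h k‖) atTop (𝓝 0) := by simpa using hh.norm
  have hHn' := (tendsto_add_atTop_iff_nat 1).2 hHn
  have hhn' := (tendsto_add_atTop_iff_nat 1).2 hhn
  have hθ0 : Tendsto θ atTop (𝓝 0) := by
    have := (((hHn.add hhn).const_mul ‖A‖).add ((hHn'.add hhn').const_mul c₁⁻¹)).add
      (hHn'.mul_const (CL + Cf))
    simpa using this
  -- The contraction rate is `l / 2`; the error `2 θ ‖u‖` uses up `l / 4` of it once `θ ≤ l / 8`,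
  -- and the remaining `2 θ` is `l / 4 * (8 / l * θ)`.
  refine ⟨l / 4, by positivity, fun k => 8 / l * θ k, by simpa using hθ0.const_mul (8 / l), ?_⟩
  have hmA : Tendsto (fun k => m k * ‖A‖ ^ 2) atTop (𝓝 0) := by simpa using hm.mul_const _
  have hml : Tendsto (fun k => m k * l) atTop (𝓝 0) := by simpa using hm.mul_const _
  filter_upwards [hHn.eventually_le_const (half_pos one_pos),
    hhn.eventually_le_const (half_pos one_pos), hθ0.eventually_le_const (by positivity : 0 < l / 8),
    hmA.eventually_le_const hl, hml.eventually_le_const one_pos]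
    with k hHk hhk hθk hAk hlk y z hz
  set u := y + H k y - h k with hu
  set r := A (H k y - h k) - c₁⁻¹ • H (k + 1) y - H (k + 1) (L k y) + H (k + 1) (f k) +
    c₁⁻¹ • h (k + 1) with hr
  -- Every term of `r` carries a factor `H` or `h`, hence is small relative to `‖y‖ + 1`.
  have key : z + H (k + 1) z - h (k + 1) = (u - m k • A u) + m k • r := by
    have e1 : H (k + 1) y = H k y + m k • (L k y - A y) - (m k / c₁) • H (k + 1) y := by
      conv_lhs => rw [hH_succ k]
      simp
    have e2 := hh_succ k
    have e3 : y = u - H k y + h k := by rw [hu]; abel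
    have e4 : A u = A y + A (H k y) - A (h k) := by rw [hu]; simp
    rw [hz, e4, hr, map_add, map_sub, map_smul, map_smul, map_sub, hu]
    linear_combination (norm := module) e1 - e2
  have hCL : 0 ≤ CL := (norm_nonneg _).trans (hL 0)
  have hCf : 0 ≤ Cf := (norm_nonneg _).trans (hf 0)
  have hyu : ‖y‖ ≤ 2 * ‖u‖ + 1 := by
    have h1 : ‖y‖ ≤ ‖u‖ + ‖H k y‖ + ‖h k‖ := by
      have : y = u - H k y + h k := by rw [hu]; abel
      calc ‖y‖ = ‖u - H k y + h k‖ := congrArg _ this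
        _ ≤ _ := (norm_add_le _ _).trans (by gcongr; exact norm_sub_le _ _)
    have h2 := (H k).le_opNorm y
    nlinarith [norm_nonneg y]
  have hrn : ‖r‖ ≤ θ k * (‖y‖ + 1) := by
    have b1 : ‖A (H k y - h k)‖ ≤ ‖A‖ * (‖H k‖ * ‖y‖ + ‖h k‖) :=
      (A.le_opNorm _).trans (by
        gcongr
        exact (norm_sub_le _ _).trans (by gcongr; exact (H k).le_opNorm y))
    have b2 : ‖c₁⁻¹ • H (k + 1) y‖ ≤ c₁⁻¹ * (‖H (k + 1)‖ * ‖y‖) := by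
      rw [norm_smul, Real.norm_of_nonneg (by positivity)]
      gcongr
      exact (H (k + 1)).le_opNorm y
    have b3 : ‖H (k + 1) (L k y)‖ ≤ ‖H (k + 1)‖ * (CL * ‖y‖) :=
      (ContinuousLinearMap.le_opNorm _ _).trans (by
        gcongr
        exact ((L k).le_opNorm y).trans (by gcongr; exact hL k))
    have b4 : ‖H (k + 1) (f k)‖ ≤ ‖H (k + 1)‖ * Cf :=
      (ContinuousLinearMap.le_opNorm _ _).trans (by gcongr; exact hf k)
    have b5 : ‖c₁⁻¹ • h (k + 1)‖ = c₁⁻¹ * ‖h (k + 1)‖ := by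
      rw [norm_smul, Real.norm_of_nonneg (by positivity)]
    have b6 : ‖r‖ ≤ ‖A (H k y - h k)‖ + ‖c₁⁻¹ • H (k + 1) y‖ + ‖H (k + 1) (L k y)‖ +
        ‖H (k + 1) (f k)‖ + ‖c₁⁻¹ • h (k + 1)‖ := by
      refine (norm_add_le _ _).trans (add_le_add_left ?_ _)
      refine (norm_add_le _ _).trans (add_le_add_left ?_ _)
      refine (norm_sub_le _ _).trans (add_le_add_left ?_ _)
      exact norm_sub_le _ _
    have p1 : 0 ≤ ‖A‖ * ‖H k‖ := by positivity
    have p2 : 0 ≤ ‖A‖ * ‖h k‖ * ‖y‖ := by positivity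
    have p3 : 0 ≤ c₁⁻¹ * ‖H (k + 1)‖ := by positivity
    have p4 : 0 ≤ c₁⁻¹ * ‖h (k + 1)‖ * ‖y‖ := by positivity
    have p5 : 0 ≤ ‖H (k + 1)‖ * CL := by positivity
    have p6 : 0 ≤ ‖H (k + 1)‖ * Cf * ‖y‖ := by positivity
    simp only [hθ]
    linarith
  have hθk0 : 0 ≤ θ k := by simp only [hθ]; positivity
  have h1 := norm_sub_smul_le_of_coercive hcoer (hm0 k) hAk hlk u
  have h2 : ‖m k • r‖ ≤ m k * (2 * θ k * (‖u‖ + 1)) := by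
    rw [norm_smul, Real.norm_of_nonneg (hm0 k)]
    refine mul_le_mul_of_nonneg_left (hrn.trans ?_) (hm0 k)
    nlinarith
  rw [key]
  refine (norm_add_le _ _).trans ((add_le_add h1 h2).trans ?_)
  have h3 : m k * ‖u‖ * θ k ≤ m k * ‖u‖ * (l / 8) :=
    mul_le_mul_of_nonneg_left hθk (mul_nonneg (hm0 k) (norm_nonneg _))
  have h4 : l / 4 * m k * (8 / l * θ k) = 2 * m k * θ k := by field_simp; ring
  rw [h4]
  linarith

/-! ### Second moments and orthogonality of the noise. -/

variable {Ω : Type*} [MeasurableSpace Ω] {P : Measure Ω}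

lemma MeasureTheory.MemLp.integrable_real_inner {X Y : Ω → E} (hX : MemLp X 2 P)
    (hY : MemLp Y 2 P) : Integrable (fun ω => inner ℝ (X ω) (Y ω)) P := by
  refine (hX.norm.integrable_sq.add hY.norm.integrable_sq).mono'
    (hX.1.inner hY.1) (Eventually.of_forall fun ω => ?_)
  simp only [Pi.add_apply]
  refine (norm_inner_le_norm _ _).trans ?_
  nlinarith [sq_nonneg (‖X ω‖ - ‖Y ω‖), sq_nonneg ‖X ω‖, sq_nonneg ‖Y ω‖]

lemma integral_norm_add_sq_of_integral_inner_eq_zero {X Y : Ω → E} (hX : MemLp X 2 P)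
    (hY : MemLp Y 2 P) (hXY : ∫ ω, inner ℝ (X ω) (Y ω) ∂P = 0) :
    ∫ ω, ‖X ω + Y ω‖ ^ 2 ∂P = ∫ ω, ‖X ω‖ ^ 2 ∂P + ∫ ω, ‖Y ω‖ ^ 2 ∂P := by
  simp only [norm_add_sq_real]
  have h1 := hX.norm.integrable_sq
  have h2 := hY.norm.integrable_sq
  have h3 := (hX.integrable_real_inner hY).const_mul 2
  rw [integral_add (by exact h1.add h3) h2, integral_add h1 h3, integral_const_mul, hXY]
  ring

variable [FiniteDimensional ℝ E]

/-- An affine image of a variable uncorrelated with `W` is uncorrelated with centred `W`. -/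
lemma integral_inner_affine_eq_zero [IsFiniteMeasure P]
    {F : Type*} [NormedAddCommGroup F] [InnerProductSpace ℝ F] [FiniteDimensional ℝ F]
    {Y : Ω → E} {W : Ω → F} (hY : MemLp Y 2 P) (hW : MemLp W 2 P) (hW0 : ∫ ω, W ω ∂P = 0)
    (hYW : ∀ T : F →L[ℝ] E, ∫ ω, inner ℝ (Y ω) (T (W ω)) ∂P = 0)
    (S : E →L[ℝ] E) (c : E) (T : F →L[ℝ] E) :
    ∫ ω, inner ℝ (S (Y ω) + c) (T (W ω)) ∂P = 0 := by
  have hTW := hW.continuousLinearMap_comp T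
  have hS : MemLp (fun ω => S (Y ω)) 2 P := hY.continuousLinearMap_comp S
  simp only [inner_add_left]
  rw [integral_add (hS.integrable_real_inner hTW)
    ((memLp_const c).integrable_real_inner hTW),
    integral_inner (hTW.integrable one_le_two), T.integral_comp_comm (hW.integrable one_le_two),
    hW0, map_zero, inner_zero_right, add_zero]
  simpa [ContinuousLinearMap.adjoint_inner_right] using hYW ((ContinuousLinearMap.adjoint S) ∘L T)

/-- Mean square convergence to zero for a linear stochastic approximation recursion whose
coefficients converge only in time average. -/
theorem tendsto_integral_norm_sq_of_averaged_recursion [IsProbabilityMeasure P]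
    {L : ℕ → E →L[ℝ] E} {A : E →L[ℝ] E} {f : ℕ → E} {Y W : ℕ → Ω → E}
    {c₁ c₂ CL Cf C : ℝ} {m : ℕ → ℝ} (hc₁ : 0 < c₁) (hc₂ : 0 < c₂)
    (hm : ∀ k, m k = c₁ / ((k : ℝ) + c₂))
    (hL : ∀ k, ‖L k‖ ≤ CL) (hf : ∀ k, ‖f k‖ ≤ Cf)
    (hA : ∀ u, u ≠ 0 → 0 < inner ℝ u (A u))
    (hLA : Tendsto (timeAverage L) atTop (𝓝 A)) (hf0 : Tendsto (timeAverage f) atTop (𝓝 0))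
    (hY : ∀ k ω, Y (k + 1) ω = Y k ω - m k • L k (Y k ω) + m k • f k + m k • W k ω)
    (hYL2 : ∀ k, MemLp (Y k) 2 P) (hWL2 : ∀ k, MemLp (W k) 2 P)
    (hWC : ∀ k, ∫ ω, ‖W k ω‖ ^ 2 ∂P ≤ C) (hW0 : ∀ k, ∫ ω, W k ω ∂P = 0)
    (hYW : ∀ k, ∀ T : E →L[ℝ] E, ∫ ω, inner ℝ (Y k ω) (T (W k ω)) ∂P = 0) :
    Tendsto (fun k => ∫ ω, ‖Y k ω‖ ^ 2 ∂P) atTop (𝓝 0) := by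
  have hm0 : ∀ k, 0 ≤ m k := fun k => by rw [hm]; positivity
  have hmlim := tendsto_gain hm
  set H : ℕ → E →L[ℝ] E := fun k => m k • ∑ j ∈ Finset.range k, (L j - A) with hHdef
  set h : ℕ → E := fun k => m k • ∑ j ∈ Finset.range k, f j with hhdef
  have hH : Tendsto H atTop (𝓝 0) := tendsto_gain_smul_sum hm hLA
  have hh : Tendsto h atTop (𝓝 0) := by simpa using tendsto_gain_smul_sum hm hf0
  obtain ⟨β, hβ, η, hη, hstep⟩ := exists_corrected_step_contraction hc₁ hm0 hmlim hL hf hA hH hh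
    (fun k => gain_smul_sum_succ hc₁ hc₂ hm (fun j => L j - A) k)
    (fun k => gain_smul_sum_succ hc₁ hc₂ hm f k)
  have hHn : Tendsto (fun k => ‖H k‖) atTop (𝓝 0) := by simpa using hH.norm
  have hhn : Tendsto (fun k => ‖h k‖) atTop (𝓝 0) := by simpa using hh.norm
  have hUL2 : ∀ k, MemLp (fun ω => Y k ω + H k (Y k ω) - h k) 2 P := fun k =>
    ((hYL2 k).add ((hYL2 k).continuousLinearMap_comp (H k))).sub (memLp_const _)
  have hU : Tendsto (fun k => ∫ ω, ‖Y k ω + H k (Y k ω) - h k‖ ^ 2 ∂P) atTop (𝓝 0) := by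
    refine tendsto_zero_of_le_contraction (α := fun k => β * m k)
      (b := fun k => η k ^ 2 + 4 * C / β * m k)
      (fun k => integral_nonneg fun ω => by positivity)
      (fun k => mul_nonneg hβ.le (hm0 k)) (by simpa using hmlim.const_mul β) ?_ ?_ ?_
    · simp only [← Finset.mul_sum]
      exact (tendsto_sum_gain hc₁ hc₂ hm).const_mul_atTop hβ
    · simpa using (hη.pow 2).add (hmlim.const_mul (4 * C / β))
    have hβm : Tendsto (fun k => β * m k) atTop (𝓝 0) := by simpa using hmlim.const_mul β
    filter_upwards [hstep, hβm.eventually_le_const one_pos,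
      ((tendsto_add_atTop_iff_nat 1).2 hHn).eventually_le_const one_pos] with k hk hβk hHk
    -- The next corrected state is affine in `Y k` plus linear in the noise, so the cross term has
    -- zero mean.
    set S : E →L[ℝ] E := (ContinuousLinearMap.id ℝ E + H (k + 1)) ∘L
      (ContinuousLinearMap.id ℝ E - m k • L k) with hS
    set c : E := m k • f k + H (k + 1) (m k • f k) - h (k + 1) with hc
    set T : E →L[ℝ] E := m k • (ContinuousLinearMap.id ℝ E + H (k + 1)) with hT
    have hSc : ∀ ω, S (Y k ω) + c = (Y k ω - m k • L k (Y k ω) + m k • f k) +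
        H (k + 1) (Y k ω - m k • L k (Y k ω) + m k • f k) - h (k + 1) := by
      intro ω
      simp only [hS, hc, ContinuousLinearMap.comp_apply, add_apply,
        sub_apply, ContinuousLinearMap.id_apply,
        smul_apply, map_add, map_sub]
      abel
    have hsplit : ∀ ω, Y (k + 1) ω + H (k + 1) (Y (k + 1) ω) - h (k + 1) =
        (S (Y k ω) + c) + T (W k ω) := by
      intro ω
      rw [hSc, hY]
      simp only [hT, add_apply, ContinuousLinearMap.id_apply,
        smul_apply, map_add, map_sub, map_smul, smul_add]
      abel
    have hSL2 : MemLp (fun ω => S (Y k ω) + c) 2 P :=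
      ((hYL2 k).continuousLinearMap_comp S).add (memLp_const c)
    have hTL2 : MemLp (fun ω => T (W k ω)) 2 P := (hWL2 k).continuousLinearMap_comp T
    simp only [hsplit]
    rw [integral_norm_add_sq_of_integral_inner_eq_zero hSL2 hTL2
      (integral_inner_affine_eq_zero (hYL2 k) (hWL2 k) (hW0 k) (hYW k) S c T)]
    have hTn : ∀ w, ‖T w‖ ^ 2 ≤ 4 * m k ^ 2 * ‖w‖ ^ 2 := by
      intro w
      have h1 : ‖T w‖ ≤ 2 * m k * ‖w‖ := by
        rw [hT, smul_apply, norm_smul, Real.norm_of_nonneg (hm0 k),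
          add_apply, ContinuousLinearMap.id_apply]
        have h2 : ‖w + H (k + 1) w‖ ≤ 2 * ‖w‖ := by
          have h3 := norm_add_le w (H (k + 1) w)
          have h4 := (H (k + 1)).le_of_opNorm_le hHk w
          linarith
        nlinarith [mul_le_mul_of_nonneg_left h2 (hm0 k)]
      calc ‖T w‖ ^ 2 ≤ (2 * m k * ‖w‖) ^ 2 := pow_le_pow_left₀ (norm_nonneg _) h1 2
        _ = _ := by ring
    have hnoise : ∫ ω, ‖T (W k ω)‖ ^ 2 ∂P ≤ 4 * m k ^ 2 * C := by
      calc ∫ ω, ‖T (W k ω)‖ ^ 2 ∂P ≤ ∫ ω, 4 * m k ^ 2 * ‖W k ω‖ ^ 2 ∂P :=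
            integral_mono hTL2.norm.integrable_sq ((hWL2 k).norm.integrable_sq.const_mul _)
              fun ω => hTn _
        _ = 4 * m k ^ 2 * ∫ ω, ‖W k ω‖ ^ 2 ∂P := integral_const_mul _ _
        _ ≤ _ := mul_le_mul_of_nonneg_left (hWC k) (by positivity)
    have hdrift : ∫ ω, ‖S (Y k ω) + c‖ ^ 2 ∂P ≤
        (1 - β * m k) * ∫ ω, ‖Y k ω + H k (Y k ω) - h k‖ ^ 2 ∂P + β * m k * η k ^ 2 := by
      calc ∫ ω, ‖S (Y k ω) + c‖ ^ 2 ∂P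
          ≤ ∫ ω, ((1 - β * m k) * ‖Y k ω + H k (Y k ω) - h k‖ ^ 2 + β * m k * η k ^ 2) ∂P := by
            refine integral_mono hSL2.norm.integrable_sq
              (((hUL2 k).norm.integrable_sq.const_mul _).add (integrable_const _)) fun ω => ?_
            have h1 := hk (Y k ω) _ rfl
            rw [← hSc] at h1
            have h2 := pow_le_pow_left₀ (norm_nonneg _) h1 2
            refine h2.trans ?_
            -- Convexity of the square, with weights `1 - β * m k` and `β * m k`.
            have h3 : 0 ≤ (1 - β * m k) * (β * m k) :=
              mul_nonneg (sub_nonneg.2 hβk) (mul_nonneg hβ.le (hm0 k))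
            nlinarith [mul_nonneg h3 (sq_nonneg (‖Y k ω + H k (Y k ω) - h k‖ - η k))]
        _ = _ := by
            rw [integral_add ((hUL2 k).norm.integrable_sq.const_mul _) (integrable_const _),
              integral_const_mul, integral_const, probReal_univ, one_smul]
    have hfin : β * m k * (η k ^ 2 + 4 * C / β * m k) =
        β * m k * η k ^ 2 + 4 * m k ^ 2 * C := by
      field_simp
    rw [hfin]
    linarith
  -- Undoing the change of variables: `‖H k‖ ≤ 1/2` gives `‖Y‖ ≤ 2 (‖u‖ + ‖h‖)`, whence the factor
  -- 8.
  have hlim : Tendsto (fun k => 8 * ∫ ω, ‖Y k ω + H k (Y k ω) - h k‖ ^ 2 ∂P + 8 * ‖h k‖ ^ 2)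
      atTop (𝓝 0) := by
    simpa using (hU.const_mul 8).add ((hhn.pow 2).const_mul 8)
  refine squeeze_zero' (Eventually.of_forall fun k => integral_nonneg fun ω => by positivity)
    ?_ hlim
  filter_upwards [hHn.eventually_le_const (half_pos one_pos)] with k hHk
  calc ∫ ω, ‖Y k ω‖ ^ 2 ∂P
      ≤ ∫ ω, (8 * ‖Y k ω + H k (Y k ω) - h k‖ ^ 2 + 8 * ‖h k‖ ^ 2) ∂P := by
        refine integral_mono (hYL2 k).norm.integrable_sq
          (((hUL2 k).norm.integrable_sq.const_mul _).add (integrable_const _)) fun ω => ?_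
        set u := Y k ω + H k (Y k ω) - h k with hu
        have h1 : ‖Y k ω‖ ≤ ‖u‖ + ‖H k (Y k ω)‖ + ‖h k‖ := by
          have : Y k ω = u - H k (Y k ω) + h k := by rw [hu]; abel
          calc ‖Y k ω‖ = ‖u - H k (Y k ω) + h k‖ := congrArg _ this
            _ ≤ _ := (norm_add_le _ _).trans (by gcongr; exact norm_sub_le _ _)
        have h2 := (H k).le_of_opNorm_le hHk (Y k ω)
        have h3 : ‖Y k ω‖ ≤ 2 * (‖u‖ + ‖h k‖) := by linarith
        have h4 := pow_le_pow_left₀ (norm_nonneg _) h3 2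
        simp only
        nlinarith [sq_nonneg (‖u‖ - ‖h k‖)]
    _ = _ := by
        rw [integral_add ((hUL2 k).norm.integrable_sq.const_mul _) (integrable_const _),
          integral_const_mul, integral_const, probReal_univ, one_smul]

lemma ProbabilityTheory.IndepFun.integral_inner_map_eq_zero [IsFiniteMeasure P]
    [MeasurableSpace E] [BorelSpace E]
    {F : Type*} [NormedAddCommGroup F] [InnerProductSpace ℝ F] [FiniteDimensional ℝ F]
    [MeasurableSpace F] [BorelSpace F] {X : Ω → E} {W : Ω → F} (h : IndepFun X W P)
    (hX : MemLp X 2 P) (hW : MemLp W 2 P) (hW0 : ∫ ω, W ω ∂P = 0) (T : F →L[ℝ] E) :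
    ∫ ω, inner ℝ (X ω) (T (W ω)) ∂P = 0 := by
  have hT : Measurable T := T.continuous.measurable
  have h1 := (h.comp measurable_id hT).integral_bilin (hX.integrable one_le_two)
    (T.integrable_comp (hW.integrable one_le_two)) (innerSL ℝ)
  refine h1.trans ?_
  simp only [Function.comp_apply]
  rw [T.integral_comp_comm (hW.integrable one_le_two), hW0, map_zero, map_zero]

/-- The state of a linear recursion driven by uncorrelated centred noise is uncorrelated with
the present and future noise. -/
lemma integral_inner_recursion_eq_zero [IsFiniteMeasure P]
    {F : Type*} [NormedAddCommGroup F] [InnerProductSpace ℝ F] [FiniteDimensional ℝ F]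
    {S : ℕ → E →L[ℝ] E} {c : ℕ → E} {D : ℕ → F →L[ℝ] E} {Y : ℕ → Ω → E} {w : ℕ → Ω → F}
    (hY : ∀ k ω, Y (k + 1) ω = S k (Y k ω) + c k + D k (w k ω))
    (hYL2 : ∀ k, MemLp (Y k) 2 P) (hwL2 : ∀ k, MemLp (w k) 2 P) (hw0 : ∀ k, ∫ ω, w k ω ∂P = 0)
    (hY0w : ∀ j, ∀ T : F →L[ℝ] E, ∫ ω, inner ℝ (Y 0 ω) (T (w j ω)) ∂P = 0)
    (hww : ∀ k j, k ≠ j → ∀ T T' : F →L[ℝ] E, ∫ ω, inner ℝ (T (w k ω)) (T' (w j ω)) ∂P = 0)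
    (k : ℕ) : ∀ j, k ≤ j → ∀ T : F →L[ℝ] E, ∫ ω, inner ℝ (Y k ω) (T (w j ω)) ∂P = 0 := by
  induction k with
  | zero => exact fun j _ => hY0w j
  | succ k ih =>
    intro j hkj T
    simp only [hY, inner_add_left _ (D k _)]
    have h1 : MemLp (fun ω => S k (Y k ω) + c k) 2 P :=
      ((hYL2 k).continuousLinearMap_comp (S k)).add (memLp_const _)
    have h2 : MemLp (fun ω => D k (w k ω)) 2 P := (hwL2 k).continuousLinearMap_comp (D k)
    have h3 : MemLp (fun ω => T (w j ω)) 2 P := (hwL2 j).continuousLinearMap_comp T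
    rw [integral_add (h1.integrable_real_inner h3) (h2.integrable_real_inner h3),
      integral_inner_affine_eq_zero (hYL2 k) (hwL2 j) (hw0 j) (ih j (by omega)),
      hww k j (by omega), add_zero]

end Hilbert

/-! ### Application to the DiSync error. -/

lemma timeAverage_map {M N : Type*} [AddCommGroup M] [Module ℝ M] [AddCommGroup N] [Module ℝ N]
    (φ : M →ₗ[ℝ] N) (A : ℕ → M) (t : ℕ) :
    timeAverage (fun k => φ (A k)) t = φ (timeAverage A t) := by
  simp [timeAverage]

lemma exists_norm_map_le_of_finite_range {M N : Type*} [NormedAddCommGroup N]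
    {A : ℕ → M} (hA : (Set.range A).Finite) (φ : M → N) : ∃ C : ℝ, ∀ k, ‖φ (A k)‖ ≤ C := by
  obtain ⟨C, hC⟩ := (hA.image fun a => ‖φ a‖).bddAbove
  exact ⟨C, fun k => hC ⟨A k, ⟨k, rfl⟩, rfl⟩⟩

section Graph

variable {B R : Type*} [Fintype B] [DecidableEq B] [Fintype R] [DecidableEq R]

/-- A finite node set carries finitely many graphs; this makes all coefficient bounds uniform in
`k`. -/
lemma finite_range_groundedLaplacian_weightMatrix (G : ℕ → SimpleGraph (B ⊕ R))
    [∀ k, DecidableRel (G k).Adj] :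
    (Set.range fun k => (groundedLaplacian (G k), weightMatrix (G k))).Finite := by
  classical
  refine (Set.finite_range fun H : SimpleGraph (B ⊕ R) =>
    (groundedLaplacian H, weightMatrix H)).subset ?_
  rintro _ ⟨k, rfl⟩
  exact ⟨G k, by simp only; congr!⟩

end Graph

theorem theorem1 {B R Ω : Type*} [Fintype B] [DecidableEq B] [Fintype R] [DecidableEq R]
    [Nonempty R] [MeasurableSpace Ω] (P : Measure Ω) [IsProbabilityMeasure P]
    -- node variables, measurement graphs, measurement noises, initial estimates
    (x : B ⊕ R → ℝ) (G : ℕ → SimpleGraph (B ⊕ R)) [∀ k, DecidableRel (G k).Adj]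
    (ξ : ℕ → Ω → B → B ⊕ R → ℝ) (x₀ : Ω → B → ℝ)
    -- the stacked noise vector `ε(k)`
    (ε : ℕ → Ω → EuclideanSpace ℝ (NodePair B R))
    (hε : ∀ k ω, ε k ω = stackedNoise (ξ k ω))
    -- the gains
    (m : ℕ → ℝ) (c₁ c₂ : ℝ) (hc₁ : 0 < c₁) (hc₂ : 0 < c₂)
    (hm : ∀ k, m k = c₁ / ((k : ℝ) + c₂))
    -- the estimation error `e(k)`
    (e : ℕ → Ω → EuclideanSpace ℝ B)
    (he : ∀ k ω, e k ω = diSyncError m G x (fun j => ξ j ω) (x₀ ω) k)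
    -- noise: constant mean, bounded second moments, independence
    (γ : EuclideanSpace ℝ (NodePair B R))
    (hε_meas : ∀ k, Measurable (ε k)) (hε_L2 : ∀ k, MemLp (ε k) 2 P)
    (hε_mean : ∀ k, ∫ ω, ε k ω ∂P = γ)
    (hε_bdd : ∃ C : ℝ, ∀ k, ∫ ω, ‖ε k ω‖ ^ 2 ∂P ≤ C)
    (hε_indep : ∀ k j, k ≠ j → IndepFun (ε k) (ε j) P)
    (he0_meas : Measurable (e 0)) (he0_L2 : MemLp (e 0) 2 P)
    (hε_e0 : IndepFun (fun ω k => ε k ω) (e 0) P)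
    -- uniform joint connectivity
    (hconn : ∃ d : ℕ, ∀ t : ℕ, (⨆ k ∈ Set.Ico t (t + d), G k).Connected)
    -- existence of the time averages
    (Lbar : Matrix (B ⊕ R) (B ⊕ R) ℝ) (Lbbar : Matrix B B ℝ)
    (Dbar : Matrix B (NodePair B R) ℝ)
    (hL : Tendsto (timeAverage fun k => (G k).lapMatrix ℝ) atTop (𝓝 Lbar))
    (hLb : Tendsto (timeAverage fun k => groundedLaplacian (G k)) atTop (𝓝 Lbbar))
    (hD : Tendsto (timeAverage fun k => weightMatrix (G k)) atTop (𝓝 Dbar)) :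
    -- the error obeys the grounded Laplacian recursion
    (∀ k ω, (e (k + 1) ω).ofLp =
      Matrix.mulVec (1 - m k • groundedLaplacian (G k)) (e k ω).ofLp +
        m k • Matrix.mulVec (weightMatrix (G k)) (ε k ω).ofLp) ∧
    -- the limit is well defined and the mean square error is finite
    IsUnit Lbbar.det ∧ (∀ k, MemLp (e k) 2 P) ∧
    -- mean square convergence
    Tendsto (fun k => ∫ ω, ‖e k ω -
        WithLp.toLp 2 (Matrix.mulVec Lbbar⁻¹ (Matrix.mulVec Dbar γ.ofLp))‖ ^ 2 ∂P)
      atTop (𝓝 0) ∧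
    (γ = 0 → Tendsto (fun k => ∫ ω, ‖e k ω‖ ^ 2 ∂P) atTop (𝓝 0)) := by
  have hrec : ∀ k ω, (e (k + 1) ω).ofLp =
      Matrix.mulVec (1 - m k • groundedLaplacian (G k)) (e k ω).ofLp +
        m k • Matrix.mulVec (weightMatrix (G k)) (ε k ω).ofLp := by
    intro k ω
    rw [he, he, hε, diSyncError_succ]
  have hpos : ∀ y : B → ℝ, y ≠ 0 → 0 < y ⬝ᵥ Lbbar.mulVec y := fun y hy =>
    dotProduct_averaged_groundedLaplacian_pos hconn hLb hy
  have hunit : IsUnit Lbbar.det := by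
    rw [isUnit_iff_ne_zero]
    intro hdet
    obtain ⟨v, hv, hv0⟩ := Matrix.exists_mulVec_eq_zero_iff.2 hdet
    have := hpos v hv
    rw [hv0, dotProduct_zero] at this
    exact lt_irrefl _ this
  set Φ : Matrix B B ℝ →ₗ[ℝ] (EuclideanSpace ℝ B →L[ℝ] EuclideanSpace ℝ B) :=
    LinearMap.toContinuousLinearMap.toLinearMap.comp (Matrix.toLpLin 2 2).toLinearMap with hΦ
  set Ψ : Matrix B (NodePair B R) ℝ →ₗ[ℝ]
      (EuclideanSpace ℝ (NodePair B R) →L[ℝ] EuclideanSpace ℝ B) :=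
    LinearMap.toContinuousLinearMap.toLinearMap.comp (Matrix.toLpLin 2 2).toLinearMap with hΨ
  have hΦa : ∀ M v, Φ M v = WithLp.toLp 2 (M.mulVec v.ofLp) := fun M v => rfl
  have hΨa : ∀ M v, Ψ M v = WithLp.toLp 2 (M.mulVec v.ofLp) := fun M v => rfl
  have hrec' : ∀ k ω, e (k + 1) ω = e k ω - m k • Φ (groundedLaplacian (G k)) (e k ω) +
      m k • Ψ (weightMatrix (G k)) (ε k ω) := by
    intro k ω
    apply WithLp.ofLp_injective
    rw [hrec, Matrix.sub_mulVec, Matrix.one_mulVec, Matrix.smul_mulVec]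
    rfl
  have heL2 : ∀ k, MemLp (e k) 2 P := by
    intro k
    induction k with
    | zero => exact he0_L2
    | succ k ih =>
      rw [funext (hrec' k)]
      have h1 : MemLp (fun ω => Φ (groundedLaplacian (G k)) (e k ω)) 2 P :=
        ih.continuousLinearMap_comp (Φ (groundedLaplacian (G k)))
      have h2 : MemLp (fun ω => Ψ (weightMatrix (G k)) (ε k ω)) 2 P :=
        (hε_L2 k).continuousLinearMap_comp (Ψ (weightMatrix (G k)))
      exact (ih.sub (h1.const_smul (m k))).add (h2.const_smul (m k))
  have hmain : Tendsto (fun k => ∫ ω, ‖e k ω -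
      WithLp.toLp 2 (Matrix.mulVec Lbbar⁻¹ (Matrix.mulVec Dbar γ.ofLp))‖ ^ 2 ∂P)
      atTop (𝓝 0) := by
    set s : EuclideanSpace ℝ B :=
      WithLp.toLp 2 (Matrix.mulVec Lbbar⁻¹ (Matrix.mulVec Dbar γ.ofLp)) with hs
    -- This equation makes the time average of `f` tend to zero.
    have hLs : Φ Lbbar s = Ψ Dbar γ := by
      rw [hΦa, hΨa, hs, Matrix.mulVec_mulVec, Matrix.mul_nonsing_inv _ hunit, Matrix.one_mulVec]
    set w : ℕ → Ω → EuclideanSpace ℝ (NodePair B R) := fun k ω => ε k ω - γ with hw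
    have hwL2 : ∀ k, MemLp (w k) 2 P := fun k => (hε_L2 k).sub (memLp_const _)
    have hw0 : ∀ k, ∫ ω, w k ω ∂P = 0 := fun k => by
      simp only [hw]
      rw [integral_sub ((hε_L2 k).integrable one_le_two) (integrable_const _), hε_mean,
        integral_const, probReal_univ, one_smul, sub_self]
    set f : ℕ → EuclideanSpace ℝ B := fun k =>
      Ψ (weightMatrix (G k)) γ - Φ (groundedLaplacian (G k)) s with hf
    have hfin := finite_range_groundedLaplacian_weightMatrix G
    obtain ⟨CL, hCL⟩ := exists_norm_map_le_of_finite_range hfin fun M => Φ M.1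
    obtain ⟨Cf, hCf⟩ := exists_norm_map_le_of_finite_range hfin fun M => Ψ M.2 γ - Φ M.1 s
    obtain ⟨CD, hCD⟩ := exists_norm_map_le_of_finite_range hfin fun M => Ψ M.2
    obtain ⟨C, hC⟩ := hε_bdd
    have hY : ∀ k ω, e (k + 1) ω - s = (e k ω - s) -
        m k • Φ (groundedLaplacian (G k)) (e k ω - s) + m k • f k +
        m k • Ψ (weightMatrix (G k)) (w k ω) := by
      intro k ω
      simp only [hrec', hf, hw, map_sub]
      module
    have hYL2 : ∀ k, MemLp (fun ω => e k ω - s) 2 P := fun k => (heL2 k).sub (memLp_const _)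
    have hsub : Measurable fun v : EuclideanSpace ℝ (NodePair B R) => v - γ :=
      measurable_id.sub_const γ
    -- Only second moments enter, so pairwise independence of the noises is enough.
    have horth := integral_inner_recursion_eq_zero (P := P)
      (S := fun k => ContinuousLinearMap.id ℝ _ - m k • Φ (groundedLaplacian (G k)))
      (c := fun k => m k • f k) (D := fun k => m k • Ψ (weightMatrix (G k)))
      (Y := fun k ω => e k ω - s) (w := w) (fun k ω => by rw [hY]; rfl) hYL2 hwL2 hw0
      (fun j T => by
        refine IndepFun.integral_inner_map_eq_zero ?_ (hYL2 0) (hwL2 j) (hw0 j) T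
        exact hε_e0.symm.comp (measurable_id.sub_const s) (hsub.comp (measurable_pi_apply j)))
      (fun k j hkj T T' => by
        refine IndepFun.integral_inner_map_eq_zero ?_ ((hwL2 k).continuousLinearMap_comp T)
          (hwL2 j) (hw0 j) T'
        exact (hε_indep k j hkj).comp (T.measurable.comp hsub) hsub)
    refine tendsto_integral_norm_sq_of_averaged_recursion (A := Φ Lbbar)
      (C := CD ^ 2 * (2 * C + 2 * ‖γ‖ ^ 2)) hc₁ hc₂ hm hCL hCf ?_ ?_ ?_ hY hYL2
      (fun k => (hwL2 k).continuousLinearMap_comp _) ?_ ?_ ?_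
    · intro u hu
      have := hpos u.ofLp fun h => hu (WithLp.ofLp_injective 2 h)
      rw [hΦa, EuclideanSpace.inner_eq_star_dotProduct, dotProduct_comm]
      simpa using this
    · have hc : Continuous Φ := Φ.continuous_of_finiteDimensional
      refine ((hc.tendsto Lbbar).comp hLb).congr fun t => ?_
      exact (timeAverage_map Φ _ t).symm
    · have hcΦ : Continuous Φ := Φ.continuous_of_finiteDimensional
      have hcΨ : Continuous Ψ := Ψ.continuous_of_finiteDimensional
      have hΨD : Tendsto (fun t => Ψ (timeAverage (fun k => weightMatrix (G k)) t) γ) atTop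
          (𝓝 (Ψ Dbar γ)) := ((hcΨ.clm_apply continuous_const).tendsto Dbar).comp hD
      have hΦL : Tendsto (fun t => Φ (timeAverage (fun k => groundedLaplacian (G k)) t) s) atTop
          (𝓝 (Φ Lbbar s)) := ((hcΦ.clm_apply continuous_const).tendsto Lbbar).comp hLb
      have h1 := hΨD.sub hΦL
      rw [hLs, sub_self] at h1
      refine h1.congr fun t => ?_
      simp [timeAverage, smul_sub, Finset.sum_sub_distrib]
    · intro k
      have hCD0 : 0 ≤ CD := (norm_nonneg _).trans (hCD 0)
      calc ∫ ω, ‖Ψ (weightMatrix (G k)) (w k ω)‖ ^ 2 ∂P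
          ≤ ∫ ω, CD ^ 2 * (2 * ‖ε k ω‖ ^ 2 + 2 * ‖γ‖ ^ 2) ∂P := by
            refine integral_mono ((hwL2 k).continuousLinearMap_comp _).norm.integrable_sq
              ((((hε_L2 k).norm.integrable_sq.const_mul 2).add (integrable_const _)).const_mul _)
              fun ω => ?_
            have h1 := (Ψ (weightMatrix (G k))).le_of_opNorm_le (hCD k) (w k ω)
            have h2 := pow_le_pow_left₀ (norm_nonneg _) h1 2
            have h3 : ‖w k ω‖ ^ 2 ≤ 2 * ‖ε k ω‖ ^ 2 + 2 * ‖γ‖ ^ 2 := by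
              have h4 := pow_le_pow_left₀ (norm_nonneg _) (norm_sub_le (ε k ω) γ) 2
              have h5 := sq_nonneg (‖ε k ω‖ - ‖γ‖)
              simp only [hw]
              nlinarith
            rw [mul_pow] at h2
            exact h2.trans (mul_le_mul_of_nonneg_left h3 (sq_nonneg _))
        _ = CD ^ 2 * (2 * ∫ ω, ‖ε k ω‖ ^ 2 ∂P + 2 * ‖γ‖ ^ 2) := by
            rw [integral_const_mul, integral_add ((hε_L2 k).norm.integrable_sq.const_mul 2)
              (integrable_const _), integral_const_mul, integral_const, probReal_univ, one_smul]
        _ ≤ _ := by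
            have := hC k
            gcongr
    · intro k
      rw [ContinuousLinearMap.integral_comp_comm _ ((hwL2 k).integrable one_le_two), hw0, map_zero]
    · exact fun k T => horth k k le_rfl (T ∘L Ψ (weightMatrix (G k)))
  refine ⟨hrec, hunit, heL2, hmain, fun hγ => ?_⟩
  simpa [hγ] using hmain
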